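/- Let $K$ be an algebraically closed field of characteristic zero. Let $K[[x^{1/\mathbf N}]]=\bigcup_{N\ge 1}K[[x^{1/N}]]$ be the ring of fractional power series in one variable with nonnegative exponents. For $\alpha,\beta\in K[[x^{1/\mathbf N}]]$ the contact $O(\alpha,\beta)$ is the order of $\alpha-\beta$, with $O(\alpha,\alpha)=+\infty$. Let $f\in K[[x]][y]$ be a square-free Weierstrass polynomial (monic, all coefficients other than the leading one are non-units) of degree $n$, and let $\operatorname{Zer} f$ be the set of its roots in $K[[x^{1/\mathbf N}]]$. For a nonempty set $B$ of roots let $h(B)$ be the minimal contact between elements of $B$; it is $+\infty$ if and only if $B$ has exactly one element. The Kuo-Lu tree $T(f)$ is the smallest collection of sets of roots, called bars, that contains $\operatorname{Zer} f$ and that contains with every bar $B$ having at least two elements all its postbars, i.e. the equivalence classes of $B$ under the relation $O(\alpha,\alpha')>h(B)$; we write $B\perp B'$ if $B'$ is a postbar of $B$. A bar $B$ is identified with the pseudo-ball $\alpha+x^{h(B)}K[[x^{1/\mathbf N}]]$, $\alpha\in B$ (with $\{\alpha\}$ if $h(B)=+\infty$), which does not depend on the choice of $\alpha$. Let $1\le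 k\le n$ and let $f^{(k)}=\frac{(n-k)!}{n!}\frac{d^k f}{dy^k}$ be the normalized $k$-th derivative. For $B\in T(f)$ let $m(B)$ be the number of roots of $f$ in the pseudo-ball $B$, $n_k(B)=\max\{m(B)-k,0\}$ and $t_k(B)=n_k(B)-\sum_{B\perp B'}n_k(B')$. Let $T_k(f)$ be the set of bars $B\in T(f)$ with $m(B)\ge k$, and for $B\in T_k(f)$ let $B^\circ$ be the pseudo-ball $B$ minus the union of the pseudo-balls of the postbars of $B$ that belong to $T_k(f)$. If $h(B)$ is finite, let $\lambda_B(x)$ be obtained from any element of the pseudo-ball $B$ by omitting all terms of order $\ge h(B)$. The $B$-characteristic polynomial $F_B\in K[z]\setminus\{0\}$ of $f$ is defined by $f(\lambda_B(x)+z\,x^{h(B)})=F_B(z)\,x^{q}+(\text{terms of higher order in }x)$. A polynomial $F\in K[z]$ is called $k$-regular if its $k$-th derivative is zero, or no root of $F$ of multiplicity $\le k$ is a root of its $k$-th derivative. Let $f=\prod_{i=1}^n(y-\alpha_i)$ and $f^{(k)}=\prod_{j=1}^{n-k}(y-\beta_j)$ be the Newton-Puiseux factorizations, with $\alpha_i,\beta_j\in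 K[[x^{1/\mathbf N}]]$. Then: (i) for every $B\in T_k(f)$ the set $\{j:\beta_j\in B\}$ has $n_k(B)$ elements; (ii) for every $B\in T_k(f)$ the set $\{j:\beta_j\in B^\circ\}$ has $t_k(B)$ elements; (iii) for every $j$ there is a unique $B\in T_k(f)$ such that $\beta_j\in B^\circ$; (iv) for every $B\in T_k(f)$ of finite height: if $F_B$ is $k$-regular, then $O(\alpha_i,\beta_j)=h(B)$ for all $\alpha_i\in B$ and $\beta_j\in B^\circ$; otherwise there exist $\alpha_i\in B$ and $\beta_j\in B^\circ$ with $O(\alpha_i,\beta_j)>h(B)$. -/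

import Mathlib

open Polynomial

noncomputable section

namespace KuoLu

/-- The ring `K[[x^{1/ℕ}]]` of fractional power series in one variable: the series
`∑ c_q x^q` whose exponents are nonnegative rationals with a common denominator `N ≥ 1`. -/
def FracSeries (K : Type*) [Field K] : Subring (HahnSeries ℚ K) where
  carrier := {s | ∃ N : ℕ, 0 < N ∧ ∀ q ∈ s.support, ∃ m : ℕ, q = (m : ℚ) / (N : ℚ)}
  zero_mem' := ⟨1, one_pos, fun q hq => by simp at hq⟩
  one_mem' := ⟨1, one_pos, fun q hq => by
    rw [HahnSeries.support_one] at hq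
    exact ⟨0, by simpa using hq⟩⟩
  neg_mem' := by
    rintro s ⟨N, hN, h⟩
    exact ⟨N, hN, fun q hq => h q (by simpa using hq)⟩
  add_mem' := by
    rintro s t ⟨N, hN, hs⟩ ⟨M, hM, ht⟩
    refine ⟨N * M, Nat.mul_pos hN hM, fun q hq => ?_⟩
    have hN' : (N : ℚ) ≠ 0 := by exact_mod_cast hN.ne'
    have hM' : (M : ℚ) ≠ 0 := by exact_mod_cast hM.ne'
    rcases HahnSeries.support_add_subset s t hq with h | h
    · obtain ⟨m, rfl⟩ := hs q h
      exact ⟨m * M, by push_cast; field_simp⟩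
    · obtain ⟨m, rfl⟩ := ht q h
      exact ⟨m * N, by push_cast; field_simp⟩
  mul_mem' := by
    rintro s t ⟨N, hN, hs⟩ ⟨M, hM, ht⟩
    refine ⟨N * M, Nat.mul_pos hN hM, fun q hq => ?_⟩
    have hN' : (N : ℚ) ≠ 0 := by exact_mod_cast hN.ne'
    have hM' : (M : ℚ) ≠ 0 := by exact_mod_cast hM.ne'
    obtain ⟨a, ha, b, hb, rfl⟩ := Set.mem_add.1 (HahnSeries.support_mul_subset hq)
    obtain ⟨m, rfl⟩ := hs a ha
    obtain ⟨l, rfl⟩ := ht b hb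
    exact ⟨m * M + l * N, by push_cast; field_simp⟩

variable {K : Type*} [Field K]

theorem ofPowerSeries_mem (p : PowerSeries K) :
    HahnSeries.ofPowerSeries ℚ K p ∈ FracSeries K := by
  refine ⟨1, one_pos, fun q hq => ?_⟩
  rw [HahnSeries.ofPowerSeries_apply] at hq
  obtain ⟨m, -, rfl⟩ := HahnSeries.support_embDomain_subset hq
  exact ⟨m, by simp⟩

/-- The inclusion `K[[x]] ⊆ K[[x^{1/ℕ}]]`. -/
def incl (K : Type*) [Field K] : PowerSeries K →+* FracSeries K :=
  (HahnSeries.ofPowerSeries ℚ K).codRestrict (FracSeries K) ofPowerSeries_mem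

/-- A Weierstrass polynomial: monic, all coefficients but the leading one are non-units. -/
def IsWeierstrass (f : (PowerSeries K)[X]) : Prop :=
  f.Monic ∧ ∀ i < f.natDegree, ¬ IsUnit (f.coeff i)

/-- The normalized derivative `f^{(k)} = ((n-k)!/n!) d^k f / dy^k`, where `n = deg f`. -/
def normDeriv (k : ℕ) (f : (PowerSeries K)[X]) : (PowerSeries K)[X] :=
  (((f.natDegree - k).factorial : K) / (f.natDegree.factorial : K)) • derivative^[k] f

/-- The contact `O(α, β)`, i.e. the order of `α - β`; it is `⊤` exactly when `α = β`. -/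
def contact (a b : FracSeries K) : WithTop ℚ :=
  ((a : HahnSeries ℚ K) - (b : HahnSeries ℚ K)).orderTop

open Classical in
/-- The set `Zer f` of the roots of `f` in `K[[x^{1/ℕ}]]`. -/
def zer (f : (PowerSeries K)[X]) : Finset (FracSeries K) :=
  (f.map (incl K)).roots.toFinset

/-- The height `h(B)` of a finite set `B` of series: the minimal contact between its elements.
For a one-element set it is `⊤`. -/
def height (B : Finset (FracSeries K)) : WithTop ℚ :=
  (B ×ˢ B).inf fun p => contact p.1 p.2

open Classical in
/-- The postbars of `B`: if `B` has at least two elements, the classes of `B` under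
`a ≡ b mod h(B)⁺`, that is `O(a, b) > h(B)`; a one-element set has none. -/
def postbars (B : Finset (FracSeries K)) : Finset (Finset (FracSeries K)) :=
  if 2 ≤ B.card then B.image fun a => B.filter fun b => height B < contact a b else ∅

/-- The bars of the Kuo-Lu tree `T(f)`, including the leaves (bars of infinite height). -/
inductive IsBar (f : (PowerSeries K)[X]) : Finset (FracSeries K) → Prop
  | root : IsBar f (zer f)
  | post {B B' : Finset (FracSeries K)} : IsBar f B → B' ∈ postbars B → IsBar f B'

/-- The pseudo-ball `a + x^h K[[x^{1/ℕ}]]` of centre `a` and height `h`; it is `{a}` for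
`h = ⊤`. -/
def pseudoBallAt (a : FracSeries K) : WithTop ℚ → Set (FracSeries K)
  | ⊤ => {a}
  | (h : ℚ) => {c | ∃ w : FracSeries K,
      (c : HahnSeries ℚ K) = (a : HahnSeries ℚ K) + HahnSeries.single h 1 * (w : HahnSeries ℚ K)}

/-- The pseudo-ball identified with the bar `B`: the pseudo-ball of height `h(B)` centred at any
element of `B`. -/
def ball (B : Finset (FracSeries K)) : Set (FracSeries K) :=
  {c | ∃ a ∈ B, c ∈ pseudoBallAt a (height B)}

open Classical in
/-- `m(B)`: the number of roots of `f` that belong to (the pseudo-ball of) `B`. -/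
def m (f : (PowerSeries K)[X]) (B : Finset (FracSeries K)) : ℕ :=
  ((zer f).filter fun a => a ∈ ball B).card

/-- `n_k(B) = max {m(B) - k, 0}` (truncated subtraction). -/
def n (f : (PowerSeries K)[X]) (k : ℕ) (B : Finset (FracSeries K)) : ℕ := m f B - k

/-- `t_k(B) = n_k(B) - ∑ n_k(B')`, the sum over all postbars `B'` of `B`. -/
def t (f : (PowerSeries K)[X]) (k : ℕ) (B : Finset (FracSeries K)) : ℤ :=
  (n f k B : ℤ) - ∑ B' ∈ postbars B, (n f k B' : ℤ)

/-- The bars of the subtree `T_k(f)`: the bars `B` of `T(f)` with `m(B) ≥ k`. -/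
def IsBarK (f : (PowerSeries K)[X]) (k : ℕ) (B : Finset (FracSeries K)) : Prop :=
  IsBar f B ∧ k ≤ m f B

/-- `B°`: the pseudo-ball of `B` minus those of the postbars of `B` that belong to `T_k(f)`. -/
def openPart (f : (PowerSeries K)[X]) (k : ℕ) (B : Finset (FracSeries K)) :
    Set (FracSeries K) :=
  ball B \ ⋃ B' ∈ {B' | B' ∈ postbars B ∧ IsBarK f k B'}, ball B'

/-- For a series `c`, an exponent `h` and `λ` the sum of the terms of `c` of order `< h`, the
series `f(λ + z x^h)` in fractional powers of `x` with coefficients in `K[z]`. -/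
def substSeries (f : (PowerSeries K)[X]) (c : FracSeries K) (h : ℚ) : HahnSeries ℚ K[X] :=
  f.eval₂ ((HahnSeries.ofPowerSeries ℚ K[X]).comp (PowerSeries.map (Polynomial.C : K →+* K[X])))
    ((HahnSeries.truncLT h (c : HahnSeries ℚ K)).map (Polynomial.C : K →+* K[X])
      + HahnSeries.single h (Polynomial.X : K[X]))

/-- The characteristic polynomial of `f` with respect to the pseudo-ball `c + x^h K[[x^{1/ℕ}]]`:
the `F ∈ K[z]` with `f(λ + z x^h) = F(z) x^q + (terms of higher order)`, `F ≠ 0`. It depends only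
on the pseudo-ball. -/
def charPoly (f : (PowerSeries K)[X]) (c : FracSeries K) (h : ℚ) : K[X] :=
  (substSeries f c h).leadingCoeff

/-- `F` is `k`-regular: `F^{(k)}` is zero, or no root of `F` of multiplicity `≤ k` is a root of
`F^{(k)}`. -/
def IsRegular (k : ℕ) (F : K[X]) : Prop :=
  derivative^[k] F = 0 ∨
    ∀ z : K, F.IsRoot z → F.rootMultiplicity z ≤ k → ¬ (derivative^[k] F).IsRoot z

end KuoLu

end

/-! The substitution `y = λ_B + z x^h` turns `d/dy` into `x^(-h) d/dz`. Hence, as long as `F_B^(k) ≠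
0`, this polynomial is up to a nonzero constant the characteristic polynomial of `f^(k)` at `B`
(`charPoly_iterate_derivative`). In a product of linear factors, a root in the pseudo-ball
contributes `z` minus its coefficient at `x^h`, any other root a nonzero constant
(`charPoly_eq_of_map_eq_prod`). So `deg F_B = m(B)`, and in characteristic zero `m(B) ≥ k` makes
`F_B^(k)` nonzero of degree `m(B) - k`; this is (i) at finite height. A bar of infinite height in
`T_k(f)` is a single root with `k = 1`, and (i) says that this root is simple. Subtracting the
disjoint balls of the postbars gives (ii); descending the tree gives (iii).

For (iv), elements of the ball have contact `> h` exactly when their coefficients at `x^h` agree, so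
the roots of `F_B` correspond to the postbars `P`, with multiplicity `m(P)`. If `m(P) ≥ k`, the
multiplicity in `F_B^(k)` is `m(P) - k = n_k(P)`, which by (i) is used up by the `β_j` in the ball
of `P`. Contact `> h` inside `B°` therefore means a common root of `F_B` and `F_B^(k)` of
multiplicity `< k` in `F_B`; `≤ k` is the same condition, since multiplicity `k` leaves no root of
`F_B^(k)`. -/

namespace KuoLu

/-! ### Differentiation in `z` of Hahn series over `R[z]`. -/

section HahnPolynomial

variable {Γ R : Type*} [PartialOrder Γ] [CommRing R]

/-- The coefficientwise derivative of a Hahn series with polynomial coefficients. -/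
noncomputable def coeffDeriv (s : HahnSeries Γ R[X]) : HahnSeries Γ R[X] :=
  s.map (derivative : R[X] →ₗ[R] R[X])

@[simp]
theorem coeff_coeffDeriv (s : HahnSeries Γ R[X]) (g : Γ) :
    (coeffDeriv s).coeff g = derivative (s.coeff g) := rfl

theorem coeffDeriv_add (s t : HahnSeries Γ R[X]) :
    coeffDeriv (s + t) = coeffDeriv s + coeffDeriv t := by
  ext1; funext g; simp

theorem support_coeffDeriv_subset (s : HahnSeries Γ R[X]) :
    (coeffDeriv s).support ⊆ s.support := by
  intro g hg h0
  exact hg (by simp [h0])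

variable [AddCommMonoid Γ] [IsOrderedCancelAddMonoid Γ]

theorem coeffDeriv_mul (s t : HahnSeries Γ R[X]) :
    coeffDeriv (s * t) = coeffDeriv s * t + s * coeffDeriv t := by
  ext1; funext g
  -- Differentiation may shrink supports, so all three products are summed over pairs from the
  -- supports of `s` and `t`.
  rw [coeff_coeffDeriv, HahnSeries.coeff_add, HahnSeries.coeff_mul,
    HahnSeries.coeff_mul_left' s.isPWO_support (support_coeffDeriv_subset s),
    HahnSeries.coeff_mul_right' t.isPWO_support (support_coeffDeriv_subset t),
    ← Finset.sum_add_distrib, derivative_sum]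
  exact Finset.sum_congr rfl fun p _ => by simp [derivative_mul]

theorem coeffDeriv_eval₂ {A : Type*} [CommRing A] (φ : A →+* HahnSeries Γ R[X])
    (hφ : ∀ a, coeffDeriv (φ a) = 0) (T : HahnSeries Γ R[X]) (p : A[X]) :
    coeffDeriv (p.eval₂ φ T) = coeffDeriv T * (derivative p).eval₂ φ T := by
  induction p using Polynomial.induction_on with
  | C a => simp [hφ]
  | add p q hp hq => simp [eval₂_add, coeffDeriv_add, hp, hq, mul_add]
  | monomial n a ih =>
    rw [pow_succ, ← mul_assoc, eval₂_mul, coeffDeriv_mul, ih, eval₂_X, derivative_mul (g := X),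
      derivative_X, eval₂_add, mul_one]
    simp only [eval₂_mul, eval₂_X]
    ring

end HahnPolynomial

/-! ### Leading coefficients of Hahn series. -/

section LeadingCoeff

variable {Γ R : Type*} [LinearOrder Γ] [CommRing R]

theorem leadingCoeff_eq_of_coeff {S : Type*} [Zero S] {s : HahnSeries Γ S} {g : Γ}
    (h0 : s.coeff g ≠ 0) (hlt : ∀ i < g, s.coeff i = 0) : s.leadingCoeff = s.coeff g := by
  have hs : s ≠ 0 := HahnSeries.ne_zero_of_coeff_ne_zero h0
  have ho : s.orderTop = g :=
    le_antisymm (HahnSeries.orderTop_le_of_coeff_ne_zero h0)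
      (HahnSeries.le_orderTop_iff_forall.2 fun j hj => hlt j (by simpa using hj))
  rw [HahnSeries.leadingCoeff_of_ne_zero hs]
  congr 1
  exact (WithTop.untop_eq_iff _).2 ho

/-- Differentiation creates no terms of lower order, and by hypothesis the lowest term survives. -/
theorem leadingCoeff_coeffDeriv {s : HahnSeries Γ R[X]} (h : derivative s.leadingCoeff ≠ 0) :
    (coeffDeriv s).leadingCoeff = derivative s.leadingCoeff := by
  have hs : s ≠ 0 := by rintro rfl; simp at h
  rw [HahnSeries.leadingCoeff_of_ne_zero hs] at h ⊢
  rw [← coeff_coeffDeriv] at h ⊢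
  refine leadingCoeff_eq_of_coeff h fun i hi => ?_
  rw [coeff_coeffDeriv, HahnSeries.coeff_eq_zero_of_lt_orderTop, map_zero]
  exact (WithTop.coe_lt_coe.2 hi).trans_eq (WithTop.coe_untop _ _)

theorem leadingCoeff_prod {ι : Type*} [AddCommMonoid Γ] [IsOrderedCancelAddMonoid Γ]
    [IsDomain R] (s : Finset ι) (F : ι → HahnSeries Γ R) :
    (∏ i ∈ s, F i).leadingCoeff = ∏ i ∈ s, (F i).leadingCoeff := by
  classical
  induction s using Finset.induction_on with
  | empty => simp
  | insert a s ha ih => rw [Finset.prod_insert ha, Finset.prod_insert ha,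
      HahnSeries.leadingCoeff_mul, ih]

end LeadingCoeff

/-! ### Characteristic polynomials of products and of derivatives. -/

variable {K : Type*} [Field K]

/-- The inclusion of Hahn series over `K` into Hahn series over `K[z]`. -/
noncomputable def constCoeff (K : Type*) [Field K] : HahnSeries ℚ K →+* HahnSeries ℚ K[X] where
  toFun s := s.map (C : K →+* K[X])
  map_zero' := by ext1; funext g; simp
  map_one' := by ext1; funext g; by_cases h : g = 0 <;> simp [HahnSeries.coeff_one, h]
  map_add' s t := by ext1; funext g; simp
  map_mul' s t := HahnSeries.map_mul (C : K →+* K[X]).toNonUnitalRingHom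

@[simp]
theorem coeff_constCoeff (s : HahnSeries ℚ K) (q : ℚ) : (constCoeff K s).coeff q = C (s.coeff q) :=
  rfl

theorem coeffDeriv_constCoeff (s : HahnSeries ℚ K) : coeffDeriv (constCoeff K s) = 0 := by
  ext1; funext g; simp

theorem constCoeff_ofPowerSeries (p : PowerSeries K) :
    constCoeff K (HahnSeries.ofPowerSeries ℚ K p) =
      HahnSeries.ofPowerSeries ℚ K[X] (PowerSeries.map (C : K →+* K[X]) p) := by
  ext1; funext q
  rw [coeff_constCoeff]
  by_cases hq : ∃ n : ℕ, (n : ℚ) = q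
  · obtain ⟨n, rfl⟩ := hq
    rw [HahnSeries.ofPowerSeries_apply_coeff, HahnSeries.ofPowerSeries_apply_coeff,
      PowerSeries.coeff_map]
  · have h : ∀ {S : Type _} [Semiring S] (r : PowerSeries S),
        (HahnSeries.ofPowerSeries ℚ S r).coeff q = 0 := by
      intro S _ r
      rw [HahnSeries.ofPowerSeries_apply]
      refine HahnSeries.embDomain_of_notMem_range ?_
      rintro ⟨n, hn⟩
      exact hq ⟨n, hn⟩
    rw [h, h, map_zero]

/-- The leading coefficient of `λ + z x^h - a`. -/
theorem leadingCoeff_linear_of_le {s : HahnSeries ℚ K} {h : ℚ} (hs : (h : WithTop ℚ) ≤ s.orderTop) :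
    (HahnSeries.single h (X : K[X]) - constCoeff K s).leadingCoeff = X - C (s.coeff h) := by
  have hc : (HahnSeries.single h (X : K[X]) - constCoeff K s).coeff h = X - C (s.coeff h) := by simp
  rw [← hc]
  refine leadingCoeff_eq_of_coeff (by rw [hc]; exact X_sub_C_ne_zero _) fun i hi => ?_
  have : s.coeff i = 0 :=
    HahnSeries.coeff_eq_zero_of_lt_orderTop ((WithTop.coe_lt_coe.2 hi).trans_le hs)
  simp [this, HahnSeries.coeff_single_of_ne hi.ne]

theorem leadingCoeff_linear_of_lt {s : HahnSeries ℚ K} {h : ℚ} (hs : s.orderTop < h) :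
    ∃ u : K, u ≠ 0 ∧
      (HahnSeries.single h (X : K[X]) - constCoeff K s).leadingCoeff = C u := by
  obtain ⟨g, hg⟩ := WithTop.ne_top_iff_exists.1 (hs.trans_le le_top).ne
  rw [← hg] at hs
  have hgh : g < h := WithTop.coe_lt_coe.1 hs
  have hne : s.coeff g ≠ 0 := HahnSeries.coeff_orderTop_ne hg.symm
  have hc : (HahnSeries.single h (X : K[X]) - constCoeff K s).coeff g = C (-s.coeff g) := by
    simp [HahnSeries.coeff_single_of_ne hgh.ne]
  refine ⟨-s.coeff g, neg_ne_zero.2 hne, ?_⟩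
  rw [← hc]
  refine leadingCoeff_eq_of_coeff (by rw [hc]; simpa using hne) fun i hi => ?_
  have : s.coeff i = 0 :=
    HahnSeries.coeff_eq_zero_of_lt_orderTop (by rw [← hg]; exact WithTop.coe_lt_coe.2 hi)
  simp [this, HahnSeries.coeff_single_of_ne (hi.trans hgh).ne]

theorem substSeries_eq_eval₂_map (f : (PowerSeries K)[X]) (c : FracSeries K) (h : ℚ) :
    substSeries f c h = (f.map (incl K)).eval₂ ((constCoeff K).comp (FracSeries K).subtype)
      (constCoeff K (HahnSeries.truncLT h (c : HahnSeries ℚ K)) + HahnSeries.single h X) := by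
  rw [eval₂_map, substSeries]
  congr 1
  ext1 p
  exact (constCoeff_ofPowerSeries p).symm

/-- Only coefficients below `h` matter, and there the truncation agrees with `c`. -/
theorem le_orderTop_sub_truncLT {a c : HahnSeries ℚ K} {h : ℚ} :
    (h : WithTop ℚ) ≤ (a - HahnSeries.truncLT h c).orderTop ↔ (h : WithTop ℚ) ≤ (a - c).orderTop := by
  rw [HahnSeries.le_orderTop_iff_forall, HahnSeries.le_orderTop_iff_forall]
  refine forall₂_congr fun j hj => ?_
  have : j < h := WithTop.coe_lt_coe.1 hj
  simp [this]

open Classical in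
/-- The characteristic polynomial of a product of linear factors. -/
theorem charPoly_eq_of_map_eq_prod {ι : Type*} [Fintype ι] {g : (PowerSeries K)[X]}
    {a : ι → FracSeries K} (hg : g.map (incl K) = ∏ i, (X - C (a i))) (c : FracSeries K) (h : ℚ) :
    ∃ u : K, u ≠ 0 ∧ charPoly g c h =
      C u * ∏ i with (h : WithTop ℚ) ≤ contact (a i) c,
        (X - C ((a i : HahnSeries ℚ K).coeff h)) := by
  set l := HahnSeries.truncLT h (c : HahnSeries ℚ K) 
  have h1 : charPoly g c h = ∏ i, (HahnSeries.single h (X : K[X]) -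
      constCoeff K ((a i : HahnSeries ℚ K) - l)).leadingCoeff := by
    rw [charPoly, substSeries_eq_eval₂_map, hg, eval₂_finsetProd, leadingCoeff_prod]
    refine Finset.prod_congr rfl fun i _ => ?_
    congr 1
    rw [eval₂_sub, eval₂_X, eval₂_C, map_sub]
    simp only [RingHom.comp_apply, Subring.subtype_apply]
    ring
  have h2 : ∀ i, ∃ u : K, u ≠ 0 ∧ (HahnSeries.single h (X : K[X]) -
      constCoeff K ((a i : HahnSeries ℚ K) - l)).leadingCoeff = C u *
        if (h : WithTop ℚ) ≤ contact (a i) c then X - C ((a i : HahnSeries ℚ K).coeff h) else 1 := by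
    intro i
    split_ifs with hi
    · refine ⟨1, one_ne_zero, ?_⟩
      rw [leadingCoeff_linear_of_le (le_orderTop_sub_truncLT.2 hi)]
      simp
    · obtain ⟨u, hu, e⟩ := leadingCoeff_linear_of_lt (not_le.1 fun h' => hi (le_orderTop_sub_truncLT.1 h'))
      exact ⟨u, hu, by rw [e, mul_one]⟩
  choose u hu hu' using h2
  refine ⟨∏ i, u i, Finset.prod_ne_zero_iff.2 fun i _ => hu i, ?_⟩
  rw [h1, Finset.prod_congr rfl fun i _ => hu' i, Finset.prod_mul_distrib, map_prod,
    Finset.prod_filter]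

/-- The chain rule: the `z`-derivative of `λ + z x^h` is `x^h`. -/
theorem coeffDeriv_substSeries (f : (PowerSeries K)[X]) (c : FracSeries K) (h : ℚ) :
    coeffDeriv (substSeries f c h) = HahnSeries.single h 1 * substSeries (derivative f) c h := by
  have hT : coeffDeriv ((HahnSeries.truncLT h (c : HahnSeries ℚ K)).map (C : K →+* K[X])
      + HahnSeries.single h (X : K[X])) = HahnSeries.single h 1 := by
    ext1; funext g
    by_cases hg : g = h
    · subst hg; simp
    · simp [HahnSeries.coeff_single_of_ne hg]
  rw [substSeries, substSeries, coeffDeriv_eval₂, hT]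
  intro p
  simp only [RingHom.comp_apply]
  rw [← constCoeff_ofPowerSeries, coeffDeriv_constCoeff]

/-- The factor `x^h` from the chain rule has leading coefficient 1. Nonvanishing of the last
derivative implies that of all earlier ones, so no lowest term is lost on the way. -/
theorem charPoly_iterate_derivative (f : (PowerSeries K)[X]) (c : FracSeries K) (h : ℚ) (k : ℕ)
    (hne : derivative^[k] (charPoly f c h) ≠ 0) :
    charPoly (derivative^[k] f) c h = derivative^[k] (charPoly f c h) := by
  induction k with
  | zero => rfl
  | succ k ih =>
    rw [Function.iterate_succ_apply'] at hne ⊢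
    have hk : derivative^[k] (charPoly f c h) ≠ 0 := fun h0 => hne (by rw [h0, map_zero])
    rw [Function.iterate_succ_apply', ← ih hk]
    rw [← ih hk] at hne
    have := leadingCoeff_coeffDeriv hne
    rw [coeffDeriv_substSeries, HahnSeries.leadingCoeff_mul, HahnSeries.leadingCoeff_of_single,
      one_mul] at this
    exact this

theorem charPoly_smul (f : (PowerSeries K)[X]) (c : FracSeries K) (h : ℚ) (r : K) :
    charPoly (r • f) c h = C r * charPoly f c h := by
  have : substSeries (r • f) c h = HahnSeries.C (C r) * substSeries f c h := by
    have e : r • f = C (PowerSeries.C r) * f := by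
      ext1 n
      simp [PowerSeries.smul_eq_C_mul]
    rw [e, substSeries, eval₂_mul, eval₂_C]
    simp [substSeries]
  rw [charPoly, this, HahnSeries.leadingCoeff_mul, charPoly, HahnSeries.C_apply,
    HahnSeries.leadingCoeff_of_single]

end KuoLu

namespace KuoLu

variable {K : Type*} [Field K]

/-! ### Contact as an ultrametric, and pseudo-balls. -/

section Contact

theorem contact_comm (a b : FracSeries K) : contact a b = contact b a := by
  rw [contact, contact, ← HahnSeries.orderTop_neg, neg_sub]

theorem contact_self (a : FracSeries K) : contact a a = ⊤ := by simp [contact]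

theorem contact_eq_top {a b : FracSeries K} : contact a b = ⊤ ↔ a = b := by
  rw [contact, HahnSeries.orderTop_eq_top, sub_eq_zero, Subtype.coe_inj]

theorem min_contact_le (a b c : FracSeries K) :
    min (contact a b) (contact b c) ≤ contact a c := by
  have := HahnSeries.min_orderTop_le_orderTop_add (x := (a : HahnSeries ℚ K) - (b : HahnSeries ℚ K))
    (y := (b : HahnSeries ℚ K) - (c : HahnSeries ℚ K))
  rwa [sub_add_sub_cancel] at this

theorem le_contact_trans {a b c : FracSeries K} {h : WithTop ℚ} (hab : h ≤ contact a b)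
    (hbc : h ≤ contact b c) : h ≤ contact a c :=
  (le_min hab hbc).trans (min_contact_le a b c)

theorem lt_contact_trans {a b c : FracSeries K} {h : WithTop ℚ} (hab : h < contact a b)
    (hbc : h < contact b c) : h < contact a c :=
  (lt_min hab hbc).trans_le (min_contact_le a b c)

/-- The link between the tree and the characteristic polynomial, whose roots are coefficients at
`x^h`. -/
theorem lt_contact_iff_coeff_eq {a b : FracSeries K} {h : ℚ} (hab : (h : WithTop ℚ) ≤ contact a b) :
    (h : WithTop ℚ) < contact a b ↔ (a : HahnSeries ℚ K).coeff h = (b : HahnSeries ℚ K).coeff h := by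
  constructor
  · intro hlt
    have := HahnSeries.coeff_eq_zero_of_lt_orderTop hlt
    rwa [HahnSeries.coeff_sub, sub_eq_zero] at this
  · intro he
    refine lt_of_le_of_ne hab fun h0 => ?_
    have := HahnSeries.coeff_orderTop_ne (x := (a : HahnSeries ℚ K) - (b : HahnSeries ℚ K)) (g := h) h0.symm
    rw [HahnSeries.coeff_sub, he, sub_self] at this
    exact this rfl

theorem shift_mem_fracSeries {s : HahnSeries ℚ K} (hs : s ∈ FracSeries K) {h : ℚ}
    (hh : (h : WithTop ℚ) ≤ s.orderTop) : HahnSeries.single (-h) 1 * s ∈ FracSeries K := by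
  obtain ⟨N, hN, H⟩ := hs
  refine ⟨N * h.den, Nat.mul_pos hN h.den_pos, fun q hq => ?_⟩
  have hc : s.coeff (q + h) ≠ 0 := by
    rw [HahnSeries.mem_support, HahnSeries.coeff_single_mul] at hq
    simpa using hq
  obtain ⟨m, hm⟩ := H _ hc
  have hq0 : 0 ≤ q := by
    have := hh.trans (HahnSeries.orderTop_le_of_coeff_ne_zero hc)
    have := WithTop.coe_le_coe.1 this
    linarith
  have hN' : (0 : ℚ) < N := by exact_mod_cast hN
  have hd : (0 : ℚ) < h.den := by exact_mod_cast h.den_pos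
  have e : q = ((m * h.den - h.num * N : ℤ) : ℚ) / ((N * h.den : ℕ) : ℚ) := by
    have e1 : q = m / N - h.num / h.den := by rw [Rat.num_div_den, ← hm]; ring
    rw [e1]; push_cast; field_simp
  -- The order bound `h` is what keeps the shifted exponents nonnegative.
  have hz : 0 ≤ (m * h.den - h.num * N : ℤ) := by
    have hmul : (q * ((N * h.den : ℕ) : ℚ)) = ((m * h.den - h.num * N : ℤ) : ℚ) := by
      rw [e]; push_cast; field_simp
    have : (0 : ℚ) ≤ ((m * h.den - h.num * N : ℤ) : ℚ) := by rw [← hmul]; positivity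
    exact_mod_cast this
  obtain ⟨z, hz'⟩ := Int.eq_ofNat_of_zero_le hz
  exact ⟨z, by rw [e, hz']; rfl⟩

/-- Reduces pseudo-balls to contact inequalities, so that the tree is handled by the ultrametric
inequality alone. -/
theorem mem_pseudoBallAt {a c : FracSeries K} {h : WithTop ℚ} :
    c ∈ pseudoBallAt a h ↔ h ≤ contact a c := by
  induction h using WithTop.recTopCoe with
  | top =>
    rw [top_le_iff, contact_eq_top, eq_comm]
    rfl
  | coe h =>
    rw [contact_comm]
    constructor
    · rintro ⟨w, hw⟩
      rw [contact, hw, add_sub_cancel_left]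
      refine le_trans ?_ HahnSeries.orderTop_add_le_mul
      rw [HahnSeries.orderTop_single one_ne_zero]
      refine le_add_of_nonneg_right (HahnSeries.le_orderTop_iff_forall.2 fun j hj => ?_)
      by_contra h0
      obtain ⟨N, hN, H⟩ := w.2
      obtain ⟨m, rfl⟩ := H j h0
      have : (m : ℚ) / N < 0 := WithTop.coe_lt_coe.1 hj
      exact absurd this (not_lt.2 (by positivity))
    · intro hh
      refine ⟨⟨_, shift_mem_fracSeries (sub_mem c.2 a.2) hh⟩, ?_⟩
      rw [← mul_assoc, HahnSeries.single_mul_single]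
      simp

end Contact

/-! ### Combinatorics of the Kuo-Lu tree. -/

section Bars

variable {B B' : Finset (FracSeries K)} {a b c : FracSeries K}

theorem height_le_contact (ha : a ∈ B) (hb : b ∈ B) : height B ≤ contact a b :=
  Finset.inf_le (f := fun p : FracSeries K × FracSeries K => contact p.1 p.2)
    (Finset.mk_mem_product ha hb)

theorem le_height {h : WithTop ℚ} (H : ∀ a ∈ B, ∀ b ∈ B, h ≤ contact a b) : h ≤ height B :=
  Finset.le_inf fun _ hp => H _ (Finset.mem_product.1 hp).1 _ (Finset.mem_product.1 hp).2

theorem height_anti (h : B' ⊆ B) : height B ≤ height B' :=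
  le_height fun _ ha _ hb => height_le_contact (h ha) (h hb)

theorem exists_contact_eq_height (hB : B.Nonempty) :
    ∃ a ∈ B, ∃ b ∈ B, contact a b = height B := by
  obtain ⟨p, hp, e⟩ := Finset.exists_mem_eq_inf (B ×ˢ B) (hB.product hB) fun p => contact p.1 p.2
  exact ⟨p.1, (Finset.mem_product.1 hp).1, p.2, (Finset.mem_product.1 hp).2, e.symm⟩

theorem two_le_card_of_height_lt_top (hh : height B < ⊤) : 2 ≤ B.card := by
  by_contra! h2
  have := Finset.card_le_one.1 (Nat.lt_succ_iff.1 h2)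
  refine hh.not_ge (le_height fun a ha b hb => ?_)
  rw [this a ha b hb, contact_self]

theorem mem_ball_iff (ha : a ∈ B) : c ∈ ball B ↔ height B ≤ contact a c := by
  constructor
  · rintro ⟨b, hb, hc⟩
    exact le_contact_trans (height_le_contact ha hb) (mem_pseudoBallAt.1 hc)
  · exact fun h => ⟨a, ha, mem_pseudoBallAt.2 h⟩

theorem subset_ball (ha : a ∈ B) : a ∈ ball B :=
  (mem_ball_iff ha).2 (by rw [contact_self]; exact le_top)

theorem ball_mono (h : B' ⊆ B) : ball B' ⊆ ball B := by
  rintro c ⟨a, ha, hc⟩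
  exact (mem_ball_iff (h ha)).2 ((height_anti h).trans (mem_pseudoBallAt.1 hc))

theorem le_contact_of_mem_ball (hb : b ∈ ball B) (hc : c ∈ ball B) : height B ≤ contact b c := by
  obtain ⟨a, ha, hb⟩ := hb
  exact le_contact_trans ((contact_comm b a).symm ▸ mem_pseudoBallAt.1 hb) ((mem_ball_iff ha).1 hc)

theorem mem_ball_of_le_contact (hb : b ∈ ball B) (hbc : height B ≤ contact b c) : c ∈ ball B := by
  obtain ⟨a, ha, hb⟩ := hb
  exact (mem_ball_iff ha).2 (le_contact_trans (mem_pseudoBallAt.1 hb) hbc)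

open Classical in
theorem mem_postbars : B' ∈ postbars B ↔
    2 ≤ B.card ∧ ∃ a ∈ B, B' = B.filter fun b => height B < contact a b := by
  unfold postbars
  split_ifs with h <;> simp [h, eq_comm]

theorem postbar_subset (h : B' ∈ postbars B) : B' ⊆ B := by
  classical
  obtain ⟨-, a, -, rfl⟩ := mem_postbars.1 h
  exact Finset.filter_subset _ _

theorem postbar_nonempty (h : B' ∈ postbars B) : B'.Nonempty := by
  classical
  obtain ⟨-, a, ha, rfl⟩ := mem_postbars.1 h
  refine ⟨a, Finset.mem_filter.2 ⟨ha, ?_⟩⟩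
  obtain ⟨x, hx, y, hy, e⟩ := exists_contact_eq_height ⟨a, ha⟩
  rw [contact_self, ← e, lt_top_iff_ne_top]
  intro htop
  have hall : ∀ u ∈ B, ∀ v ∈ B, u = v := fun u hu v hv => by
    have := height_le_contact hu hv
    rw [← e, htop, top_le_iff] at this
    exact contact_eq_top.1 this
  have : B.card ≤ 1 := Finset.card_le_one.2 hall
  have := (mem_postbars.1 h).1
  omega

theorem height_lt_contact_of_mem_postbar (h : B' ∈ postbars B) (ha : a ∈ B') (hb : b ∈ B') :
    height B < contact a b := by
  classical
  obtain ⟨-, x, -, rfl⟩ := mem_postbars.1 h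
  exact lt_contact_trans (by rw [contact_comm]; exact (Finset.mem_filter.1 ha).2)
    (Finset.mem_filter.1 hb).2

theorem height_lt_height_of_mem_postbars (h : B' ∈ postbars B) : height B < height B' := by
  obtain ⟨a, ha, b, hb, e⟩ := exists_contact_eq_height (postbar_nonempty h)
  exact e ▸ height_lt_contact_of_mem_postbar h ha hb

theorem mem_postbar_iff (h : B' ∈ postbars B) (ha : a ∈ B') :
    b ∈ B' ↔ b ∈ B ∧ height B < contact a b := by
  refine ⟨fun hb => ⟨postbar_subset h hb, height_lt_contact_of_mem_postbar h ha hb⟩, ?_⟩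
  classical
  obtain ⟨-, x, -, rfl⟩ := mem_postbars.1 h
  exact fun hb => Finset.mem_filter.2 ⟨hb.1, lt_contact_trans (Finset.mem_filter.1 ha).2 hb.2⟩

theorem postbar_eq_of_contact {P Q : Finset (FracSeries K)} (hP : P ∈ postbars B)
    (hQ : Q ∈ postbars B) (ha : a ∈ P) (hb : b ∈ Q) (hab : height B < contact a b) : P = Q := by
  have hbP : b ∈ P := (mem_postbar_iff hP ha).2 ⟨postbar_subset hQ hb, hab⟩
  ext x
  rw [mem_postbar_iff hP hbP, mem_postbar_iff hQ hb]

theorem card_postbar_lt (h : B' ∈ postbars B) : B'.card < B.card := by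
  refine Finset.card_lt_card ((postbar_subset h).ssubset_of_ne ?_)
  rintro rfl
  exact (height_lt_height_of_mem_postbars h).false

theorem exists_postbar_mem (h2 : 2 ≤ B.card) (ha : a ∈ B) : ∃ P ∈ postbars B, a ∈ P := by
  classical
  have hP : (B.filter fun b => height B < contact a b) ∈ postbars B := mem_postbars.2 ⟨h2, a, ha, rfl⟩
  refine ⟨_, hP, ?_⟩
  obtain ⟨x, hx⟩ := postbar_nonempty hP
  have hx' := (Finset.mem_filter.1 hx).2
  exact Finset.mem_filter.2 ⟨ha, by rw [contact_self]; exact hx'.trans_le le_top⟩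

theorem height_lt_contact_of_mem_ball_postbar (h : B' ∈ postbars B) (ha : a ∈ B')
    (hc : c ∈ ball B') : height B < contact a c :=
  (height_lt_height_of_mem_postbars h).trans_le ((mem_ball_iff ha).1 hc)

theorem postbar_eq_of_mem_ball {P Q : Finset (FracSeries K)} (hP : P ∈ postbars B)
    (hQ : Q ∈ postbars B) (hc : c ∈ ball P) (hc' : c ∈ ball Q) : P = Q := by
  obtain ⟨a, ha⟩ := postbar_nonempty hP
  obtain ⟨b, hb⟩ := postbar_nonempty hQ
  refine postbar_eq_of_contact hP hQ ha hb
    (lt_contact_trans (height_lt_contact_of_mem_ball_postbar hP ha hc) ?_)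
  rw [contact_comm]
  exact height_lt_contact_of_mem_ball_postbar hQ hb hc'

variable {f : (PowerSeries K)[X]}

theorem IsBar.subset_zer (hB : IsBar f B) : B ⊆ zer f := by
  induction hB with
  | root => exact subset_rfl
  | post _ h ih => exact (postbar_subset h).trans ih

theorem IsBar.nonempty (hB : IsBar f B) (hf : (zer f).Nonempty) : B.Nonempty := by
  cases hB with
  | root => exact hf
  | post _ h => exact postbar_nonempty h

/-- A bar consists of all roots in its pseudo-ball. -/
theorem IsBar.mem_of_mem_ball (hB : IsBar f B) (hc : c ∈ zer f) (hcB : c ∈ ball B) : c ∈ B := by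
  induction hB with
  | root => exact hc
  | post _ h ih =>
    obtain ⟨a, ha⟩ := postbar_nonempty h
    exact (mem_postbar_iff h ha).2 ⟨ih (ball_mono (postbar_subset h) hcB),
      height_lt_contact_of_mem_ball_postbar h ha hcB⟩

theorem IsBar.m_eq_card (hB : IsBar f B) : m f B = B.card := by
  classical
  rw [m]
  congr 1
  ext a
  rw [Finset.mem_filter]
  exact ⟨fun h => hB.mem_of_mem_ball h.1 h.2, fun h => ⟨hB.subset_zer h, subset_ball h⟩⟩

/-- A bar contained in a bar `B` is `B` itself or lies in a postbar of `B`. -/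
theorem IsBar.eq_or_subset_postbar (hB : IsBar f B) (hB' : IsBar f B') (hne : B'.Nonempty)
    (hsub : B' ⊆ B) : B' = B ∨ ∃ P ∈ postbars B, B' ⊆ P := by
  obtain ⟨a, ha⟩ := hne
  -- A strictly greater height puts `B'` inside one contact class of `B`; equal heights make the
  -- pseudo-balls coincide.
  rcases (height_anti hsub).lt_or_eq with hlt | heq
  · right
    obtain ⟨P, hP, haP⟩ :=
      exists_postbar_mem (two_le_card_of_height_lt_top (hlt.trans_le le_top)) (hsub ha)
    exact ⟨P, hP, fun b hb => (mem_postbar_iff hP haP).2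
      ⟨hsub hb, hlt.trans_le (height_le_contact ha hb)⟩⟩
  · left
    refine hsub.antisymm fun b hb => hB'.mem_of_mem_ball (hB.subset_zer hb) ?_
    exact (mem_ball_iff ha).2 (heq ▸ height_le_contact (hsub ha) hb)

/-- Two bars whose pseudo-balls meet are nested. -/
theorem IsBar.subset_of_mem_ball (hB : IsBar f B) (hB' : IsBar f B') (hc : c ∈ ball B)
    (hc' : c ∈ ball B') (hle : height B ≤ height B') : B' ⊆ B := fun _ hb =>
  hB.mem_of_mem_ball (hB'.subset_zer hb) <| mem_ball_of_le_contact hc <|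
    hle.trans (le_contact_of_mem_ball hc' (subset_ball hb))

variable {k : ℕ}

theorem IsBarK.mono {P : Finset (FracSeries K)} (hB' : IsBarK f k B') (hP : IsBar f P)
    (hsub : B' ⊆ P) : IsBarK f k P := by
  refine ⟨hP, hB'.2.trans ?_⟩
  rw [hP.m_eq_card, hB'.1.m_eq_card]
  exact Finset.card_le_card hsub

theorem mem_openPart : c ∈ openPart f k B ↔
    c ∈ ball B ∧ ∀ P ∈ postbars B, IsBarK f k P → c ∉ ball P := by
  simp [openPart]

theorem eq_of_mem_openPart (hf : (zer f).Nonempty) (hB : IsBarK f k B) (hB' : IsBarK f k B')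
    (hc : c ∈ openPart f k B) (hc' : c ∈ openPart f k B') : B = B' := by
  wlog hle : height B ≤ height B' generalizing B B'
  · exact (this hB' hB hc' hc (le_of_not_ge hle)).symm
  rw [mem_openPart] at hc hc'
  rcases hB.1.eq_or_subset_postbar hB'.1 (hB'.1.nonempty hf)
    (hB.1.subset_of_mem_ball hB'.1 hc.1 hc'.1 hle) with h | ⟨P, hP, hsub⟩
  · exact h.symm
  -- The postbar `P` between the two bars has at least as many roots as `B'`, so its ball is removed
  -- from `B°`.
  · exact absurd (ball_mono hsub hc'.1) (hc.2 P hP (hB'.mono (.post hB.1 hP) hsub))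

/-- Outside the open part, `c` lies in a postbar in `T_k(f)` with fewer roots, so the descent
terminates. -/
theorem exists_mem_openPart (hB : IsBarK f k B) (hc : c ∈ ball B) :
    ∃ P, IsBarK f k P ∧ c ∈ openPart f k P := by
  induction hn : B.card using Nat.strong_induction_on generalizing B with
  | _ N ih =>
    by_cases h : c ∈ openPart f k B
    · exact ⟨B, hB, h⟩
    · rw [mem_openPart] at h
      push Not at h
      obtain ⟨P, hP, hPk, hcP⟩ := h hc
      exact ih _ (hn ▸ card_postbar_lt hP) hPk hcP rfl

end Bars

/-! ### Simplicity of the roots. -/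

section Separable

variable [CharZero K]

/-- Since `K[[x]]` is integrally closed, the minimal polynomial `μ` of `a` divides `f = μ g`. If
`f'(a) = 0`, then `μ'(a) g(a) = 0`. The first factor cannot vanish, as `μ' ≠ 0` has smaller degree;
if the second does, `μ²` divides `f`. -/
theorem eval_map_derivative_ne_zero {f : (PowerSeries K)[X]} (hf : f.Monic) (hsq : Squarefree f)
    {a : FracSeries K} (ha : (f.map (incl K)).eval a = 0) :
    ((derivative f).map (incl K)).eval a ≠ 0 := by
  let _ : Algebra (PowerSeries K) (FracSeries K) := (incl K).toAlgebra
  have hinj : Function.Injective (incl K) := fun p q h =>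
    HahnSeries.ofPowerSeries_injective (Subtype.ext_iff.1 h)
  have : CharZero (PowerSeries K) :=
    charZero_of_injective_ringHom (f := PowerSeries.C) PowerSeries.C_injective
  have : FaithfulSMul (PowerSeries K) (FracSeries K) :=
    (faithfulSMul_iff_algebraMap_injective _ _).2 hinj
  have hev : ∀ p : (PowerSeries K)[X], (p.map (incl K)).eval a = aeval a p := fun p => by
    rw [eval_map, aeval_def]; rfl
  rw [hev] at ha ⊢
  have hint : IsIntegral (PowerSeries K) a := ⟨f, hf, by rwa [← aeval_def]⟩
  obtain ⟨g, hg⟩ := minpoly.isIntegrallyClosed_dvd hint ha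
  intro h0
  have hmin : aeval a (minpoly (PowerSeries K) a) = 0 := minpoly.aeval _ _
  rw [hg, derivative_mul, map_add, map_mul, map_mul, hmin, zero_mul, add_zero, mul_eq_zero] at h0
  have hpos := minpoly.natDegree_pos hint
  rcases h0 with h0 | h0
  · have hd : derivative (minpoly (PowerSeries K) a) ≠ 0 := fun h =>
      hpos.ne' (derivative_eq_zero.1 h)
    exact absurd (minpoly.IsIntegrallyClosed.degree_le_of_ne_zero hd h0)
      (not_le.2 (degree_derivative_lt (minpoly.ne_zero hint)))
  · obtain ⟨g', hg'⟩ := minpoly.isIntegrallyClosed_dvd hint h0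
    have hu := hsq (minpoly (PowerSeries K) a) ⟨g', by rw [mul_assoc, ← hg', ← hg]⟩
    have := natDegree_eq_zero_of_isUnit hu
    omega

end Separable

end KuoLu

namespace KuoLu

/-! ### Root counts for split polynomials and iterated derivatives. -/

section LinearFactors

variable {R ι : Type*} [CommRing R] [IsDomain R] {u : R}

theorem natDegree_C_mul_prod_X_sub_C (hu : u ≠ 0) (s : Finset ι) (a : ι → R) :
    (C u * ∏ i ∈ s, (X - C (a i))).natDegree = s.card := by
  rw [natDegree_C_mul hu, natDegree_finsetProd_X_sub_C_eq_card]

theorem rootMultiplicity_C_mul_prod_X_sub_C [DecidableEq R] (hu : u ≠ 0) (s : Finset ι)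
    (a : ι → R) (z : R) :
    (C u * ∏ i ∈ s, (X - C (a i))).rootMultiplicity z = (s.filter fun i => a i = z).card := by
  rw [← count_roots, roots_C_mul _ hu]
  have : ∏ i ∈ s, (X - C (a i)) = ((s.val.map a).map fun b => X - C b).prod := by
    rw [Multiset.map_map]; rfl
  rw [this, roots_multiset_prod_X_sub_C, Multiset.count_map]
  simp only [eq_comm (a := z)]
  rfl

theorem isRoot_C_mul_prod_X_sub_C (hu : u ≠ 0) (s : Finset ι) (a : ι → R) (z : R) :
    (C u * ∏ i ∈ s, (X - C (a i))).IsRoot z ↔ ∃ i ∈ s, a i = z := by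
  rw [IsRoot, eval_mul, eval_C, eval_prod, mul_eq_zero, Finset.prod_eq_zero_iff]
  simp [hu, sub_eq_zero, eq_comm]

variable [CharZero R]

theorem natDegree_iterate_derivative_eq (p : R[X]) (k : ℕ) :
    (derivative^[k] p).natDegree = p.natDegree - k := by
  induction k with
  | zero => rfl
  | succ k ih => rw [Function.iterate_succ_apply', natDegree_derivative, ih, Nat.sub_sub]

theorem iterate_derivative_ne_zero {p : R[X]} (hp : p ≠ 0) {k : ℕ} (hk : k ≤ p.natDegree) :
    derivative^[k] p ≠ 0 := by
  cases k with
  | zero => exact hp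
  | succ k =>
    rw [Function.iterate_succ_apply', derivative_ne_zero, natDegree_iterate_derivative_eq]
    omega

/-- Each derivative lowers a positive multiplicity by one. The boundary case, multiplicity exactly
`k`, gives 0: `z` is no longer a root. -/
theorem rootMultiplicity_iterate_derivative (p : R[X]) (z : R) {k : ℕ}
    (hk : k ≤ p.rootMultiplicity z) :
    (derivative^[k] p).rootMultiplicity z = p.rootMultiplicity z - k := by
  induction k with
  | zero => rfl
  | succ k ih =>
    have ih := ih (by omega)
    have hr : (derivative^[k] p).IsRoot z := by
      by_contra h
      rw [rootMultiplicity_eq_zero h] at ih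
      omega
    rw [Function.iterate_succ_apply', derivative_rootMultiplicity_of_root hr, ih, Nat.sub_sub]

end LinearFactors

/-! ### Roots of the `k`-th derivative in the bars. -/

variable {K : Type*} [Field K]

theorem mem_ball_iff_le_contact {B : Finset (FracSeries K)} {b c : FracSeries K}
    {h : ℚ}
    (hh : height B = h) (hc : c ∈ ball B) : b ∈ ball B ↔ (h : WithTop ℚ) ≤ contact b c := by
  rw [← hh]
  exact ⟨fun hb => le_contact_of_mem_ball hb hc,
    fun hb => mem_ball_of_le_contact hc (contact_comm b c ▸ hb)⟩

/-- The Newton-Puiseux factorizations of a monic square-free polynomial and of its normalized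
derivative. -/
structure Factorization (f : (PowerSeries K)[X]) (k : ℕ) (α : Fin f.natDegree → FracSeries K)
    (β : Fin (f.natDegree - k) → FracSeries K) : Prop where
  monic : f.Monic
  squarefree : Squarefree f
  one_le : 1 ≤ k
  le_natDegree : k ≤ f.natDegree
  map_eq : f.map (incl K) = ∏ i, (X - C (α i))
  map_normDeriv : (normDeriv k f).map (incl K) = ∏ j, (X - C (β j))

namespace Factorization

variable {f : (PowerSeries K)[X]} {k : ℕ} {α : Fin f.natDegree → FracSeries K}
  {β : Fin (f.natDegree - k) → FracSeries K} {B : Finset (FracSeries K)} {c : FracSeries K} {h : ℚ}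

theorem map_incl_ne_zero (H : Factorization f k α β) : f.map (incl K) ≠ 0 := (H.monic.map _).ne_zero

theorem mem_zer (H : Factorization f k α β) {a : FracSeries K} : a ∈ zer f ↔ ∃ i, α i = a := by
  classical
  rw [zer, Multiset.mem_toFinset, mem_roots H.map_incl_ne_zero, H.map_eq, IsRoot, eval_prod,
    Finset.prod_eq_zero_iff]
  simp [sub_eq_zero, eq_comm]

theorem zer_nonempty (H : Factorization f k α β) : (zer f).Nonempty :=
  ⟨α ⟨0, H.one_le.trans H.le_natDegree⟩, H.mem_zer.2 ⟨_, rfl⟩⟩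

open Classical in
theorem exists_charPoly_eq (H : Factorization f k α β) (c : FracSeries K) (h : ℚ) :
    ∃ u : K, u ≠ 0 ∧ charPoly f c h =
      C u * ∏ i with (h : WithTop ℚ) ≤ contact (α i) c,
        (X - C ((α i : HahnSeries ℚ K).coeff h)) :=
  charPoly_eq_of_map_eq_prod H.map_eq c h

open Classical in
theorem exists_charPoly_eq_of_mem_ball (H : Factorization f k α β)
    (hh : height B = h) (hc : c ∈ ball B) :
    ∃ u : K, u ≠ 0 ∧ charPoly f c h =
      C u * ∏ i with α i ∈ ball B, (X - C ((α i : HahnSeries ℚ K).coeff h)) := by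
  simp only [mem_ball_iff_le_contact hh hc]
  exact H.exists_charPoly_eq c h

theorem charPoly_ne_zero (H : Factorization f k α β)
    (hh : height B = h) (hc : c ∈ ball B) : charPoly f c h ≠ 0 := by
  classical
  obtain ⟨u, hu, e⟩ := H.exists_charPoly_eq_of_mem_ball hh hc
  rw [e]
  exact mul_ne_zero (C_ne_zero.2 hu) (Finset.prod_ne_zero_iff.2 fun i _ => X_sub_C_ne_zero _)

variable [CharZero K]

theorem injective (H : Factorization f k α β) : Function.Injective α := by
  intro i i' h
  by_contra hne
  have hroot : (f.map (incl K)).eval (α i) = 0 := by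
    rw [H.map_eq, eval_prod]
    exact Finset.prod_eq_zero (Finset.mem_univ i) (by simp)
  refine eval_map_derivative_ne_zero H.monic H.squarefree hroot ?_
  rw [← derivative_map, H.map_eq, ← Finset.mul_prod_erase _ _ (Finset.mem_univ i),
    ← Finset.mul_prod_erase _ _ (Finset.mem_erase.2 ⟨Ne.symm hne, Finset.mem_univ i'⟩)]
  simp [derivative_mul, h]

theorem card_filter_mem (H : Factorization f k α β) (s : Finset (FracSeries K))
    (p : FracSeries K → Prop) [DecidablePred fun i => p (α i)]
    (hs : ∀ a, a ∈ s ↔ a ∈ zer f ∧ p a) :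
    (Finset.univ.filter fun i => p (α i)).card = s.card := by
  classical
  rw [← Finset.card_image_of_injective _ H.injective]
  congr 1
  ext a
  rw [hs, H.mem_zer, Finset.mem_image]
  constructor
  · rintro ⟨i, hi, rfl⟩
    exact ⟨⟨i, rfl⟩, (Finset.mem_filter.1 hi).2⟩
  · rintro ⟨⟨i, rfl⟩, hi⟩
    exact ⟨i, Finset.mem_filter.2 ⟨Finset.mem_univ _, hi⟩, rfl⟩

open Classical in
theorem exists_iterate_derivative_charPoly_eq (H : Factorization f k α β) (c : FracSeries K) (h : ℚ)
    (hne : derivative^[k] (charPoly f c h) ≠ 0) :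
    ∃ v : K, v ≠ 0 ∧ derivative^[k] (charPoly f c h) =
      C v * ∏ j with (h : WithTop ℚ) ≤ contact (β j) c,
        (X - C ((β j : HahnSeries ℚ K).coeff h)) := by
  obtain ⟨u, hu, e⟩ := charPoly_eq_of_map_eq_prod H.map_normDeriv c h
  have hr : ((f.natDegree - k).factorial : K) / (f.natDegree.factorial : K) ≠ 0 :=
    div_ne_zero (Nat.cast_ne_zero.2 (Nat.factorial_ne_zero _))
      (Nat.cast_ne_zero.2 (Nat.factorial_ne_zero _))
  rw [normDeriv, charPoly_smul, charPoly_iterate_derivative _ _ _ _ hne] at e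
  refine ⟨_, mul_ne_zero (inv_ne_zero hr) hu, ?_⟩
  rw [C_mul, mul_assoc, ← e, ← mul_assoc, ← C_mul, inv_mul_cancel₀ hr, C_1, one_mul]

open Classical in
theorem card_roots_mem_ball (H : Factorization f k α β)
    : (Finset.univ.filter fun i => α i ∈ ball B).card = m f B := by
  rw [m]
  exact H.card_filter_mem _ (· ∈ ball B) fun a => Finset.mem_filter

theorem natDegree_charPoly (H : Factorization f k α β) (hh : height B = h) (hc : c ∈ ball B) :
    (charPoly f c h).natDegree = m f B := by
  classical
  obtain ⟨u, hu, e⟩ := H.exists_charPoly_eq_of_mem_ball hh hc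
  rw [e, natDegree_C_mul_prod_X_sub_C hu, H.card_roots_mem_ball]

theorem iterate_derivative_charPoly_ne_zero (H : Factorization f k α β)
    (hB : IsBarK f k B) (hh : height B = h)
    (hc : c ∈ ball B) : derivative^[k] (charPoly f c h) ≠ 0 :=
  iterate_derivative_ne_zero (H.charPoly_ne_zero hh hc) (by
    rw [H.natDegree_charPoly hh hc]; exact hB.2)

open Classical in
theorem exists_iterate_derivative_charPoly_eq_of_mem_ball (H : Factorization f k α β)
    (hB : IsBarK f k B) (hh : height B = h)
    (hc : c ∈ ball B) :
    ∃ v : K, v ≠ 0 ∧ derivative^[k] (charPoly f c h) =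
      C v * ∏ j with β j ∈ ball B, (X - C ((β j : HahnSeries ℚ K).coeff h)) := by
  simp only [mem_ball_iff_le_contact hh hc]
  exact H.exists_iterate_derivative_charPoly_eq c h
    (H.iterate_derivative_charPoly_ne_zero hB hh hc)

open Classical in
/-- The number of roots of the `k`-th derivative in the pseudo-ball of a bar. -/
theorem card_mem_ball (H : Factorization f k α β) (hB : IsBarK f k B) :
    (Finset.univ.filter fun j => β j ∈ ball B).card = n f k B := by
  obtain ⟨a, ha⟩ := hB.1.nonempty H.zer_nonempty
  rcases hht : height B with _ | h
  -- At infinite height `B` is a single root, so `1 ≤ k ≤ m(B) ≤ 1`; it must not be a root of `f'`.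
  · have hcard : B.card ≤ 1 := Finset.card_le_one.2 fun x hx y hy =>
      contact_eq_top.1 (top_le_iff.1 (hht.symm.trans_le (height_le_contact hx hy)))
    have hm := hB.1.m_eq_card
    have hk : k = 1 := le_antisymm (hB.2.trans (hm.trans_le hcard)) H.one_le
    have hn : n f k B = 0 := by rw [n, hm, hk]; omega
    rw [hn, Finset.card_eq_zero, Finset.filter_eq_empty_iff]
    intro j _ hj
    have haj : a = β j := contact_eq_top.1 (top_le_iff.1 (hht.symm.trans_le ((mem_ball_iff ha).1 hj)))
    have hroot : (f.map (incl K)).eval a = 0 := by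
      obtain ⟨i, rfl⟩ := H.mem_zer.1 (hB.1.subset_zer ha)
      rw [H.map_eq, eval_prod]
      exact Finset.prod_eq_zero (Finset.mem_univ i) (by simp)
    refine eval_map_derivative_ne_zero H.monic H.squarefree hroot ?_
    have h0 : ((normDeriv k f).map (incl K)).eval a = 0 := by
      rw [H.map_normDeriv, eval_prod]
      exact Finset.prod_eq_zero (Finset.mem_univ j) (by simp [haj])
    have hr : ((f.natDegree - k).factorial : K) / (f.natDegree.factorial : K) ≠ 0 :=
      div_ne_zero (Nat.cast_ne_zero.2 (Nat.factorial_ne_zero _))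
        (Nat.cast_ne_zero.2 (Nat.factorial_ne_zero _))
    have hd : derivative f = C (PowerSeries.C
        (((f.natDegree - k).factorial : K) / (f.natDegree.factorial : K))⁻¹) * normDeriv k f := by
      ext1 i
      rw [coeff_C_mul, normDeriv, coeff_smul, ← PowerSeries.smul_eq_C_mul, smul_smul,
        inv_mul_cancel₀ hr, one_smul]
      subst hk
      rfl
    rw [hd, Polynomial.map_mul, eval_mul, h0, mul_zero]
  · have hh : height B = (h : WithTop ℚ) := hht
    have hc := subset_ball ha
    obtain ⟨v, hv, e⟩ := H.exists_iterate_derivative_charPoly_eq_of_mem_ball hB hh hc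
    -- The degree of `F_B^(k)` is computed in two ways: from its factors indexed by the `β j`, and
    -- as `deg F_B - k`.
    rw [← natDegree_C_mul_prod_X_sub_C hv, ← e, natDegree_iterate_derivative_eq,
      H.natDegree_charPoly hh hc, n]

open Classical in
theorem card_mem_openPart (H : Factorization f k α β) (hB : IsBarK f k B) :
    ((Finset.univ.filter fun j => β j ∈ openPart f k B).card : ℤ) = t f k B := by
  -- A postbar outside `T_k(f)` has `m(P) < k`, so the truncation makes `n_k(P) = 0`; the sum may
  -- run over all postbars.
  have hS : ∀ P ∈ postbars B,
      (Finset.univ.filter fun j => IsBarK f k P ∧ β j ∈ ball P).card = n f k P := by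
    intro P hP
    by_cases hPk : IsBarK f k P
    · simp only [hPk, true_and]
      exact H.card_mem_ball hPk
    · have : ¬ k ≤ m f P := fun h => hPk ⟨.post hB.1 hP, h⟩
      simp only [hPk, false_and, Finset.filter_false, Finset.card_empty, n]
      omega
  have hunion : (Finset.univ.filter fun j => β j ∈ ball B) =
      (Finset.univ.filter fun j => β j ∈ openPart f k B) ∪
        (postbars B).biUnion fun P => Finset.univ.filter fun j => IsBarK f k P ∧ β j ∈ ball P := by
    ext j
    simp only [Finset.mem_union, Finset.mem_biUnion, Finset.mem_filter, Finset.mem_univ, true_and,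
      mem_openPart]
    constructor
    · intro hj
      by_cases hP : ∃ P ∈ postbars B, IsBarK f k P ∧ β j ∈ ball P
      · exact .inr hP
      · exact .inl ⟨hj, fun P hP1 hP2 hP3 => hP ⟨P, hP1, hP2, hP3⟩⟩
    · rintro (hj | ⟨P, hP, -, hj⟩)
      · exact hj.1
      · exact ball_mono (postbar_subset hP) hj
  have hdisj : Disjoint (Finset.univ.filter fun j => β j ∈ openPart f k B)
      ((postbars B).biUnion fun P => Finset.univ.filter fun j => IsBarK f k P ∧ β j ∈ ball P) := by
    rw [Finset.disjoint_left]
    simp only [Finset.mem_biUnion, Finset.mem_filter, Finset.mem_univ, true_and, mem_openPart]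
    rintro j ⟨-, hj⟩ ⟨P, hP, hPk, hjP⟩
    exact hj P hP hPk hjP
  have hpair : Set.PairwiseDisjoint (postbars B : Set (Finset (FracSeries K)))
      fun P => Finset.univ.filter fun j => IsBarK f k P ∧ β j ∈ ball P := by
    intro P hP Q hQ hne
    rw [Function.onFun, Finset.disjoint_left]
    simp only [Finset.mem_filter, Finset.mem_univ, true_and]
    rintro j ⟨-, hj⟩ ⟨-, hj'⟩
    exact hne (postbar_eq_of_mem_ball hP hQ hj hj')
  have hcard := H.card_mem_ball hB
  rw [hunion, Finset.card_union_of_disjoint hdisj, Finset.card_biUnion hpair,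
    Finset.sum_congr rfl hS] at hcard
  rw [t, ← hcard]
  push_cast
  ring

theorem isBarK_zer (H : Factorization f k α β)
    : IsBarK f k (zer f) ∧ m f (zer f) = f.natDegree := by
  classical
  have hm : m f (zer f) = f.natDegree := by
    rw [← H.card_roots_mem_ball, Finset.filter_true_of_mem, Finset.card_univ, Fintype.card_fin]
    exact fun i _ => subset_ball (H.mem_zer.2 ⟨i, rfl⟩)
  exact ⟨⟨.root, H.le_natDegree.trans_eq hm.symm⟩, hm⟩

theorem mem_ball_zer (H : Factorization f k α β)
    (j : Fin (f.natDegree - k)) : β j ∈ ball (zer f) := by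
  classical
  -- The count for the root bar is the number of all indices `j`.
  have h := H.card_mem_ball H.isBarK_zer.1
  rw [n, H.isBarK_zer.2] at h
  have := (Finset.card_eq_iff_eq_univ _).1 (h.trans (Fintype.card_fin _).symm)
  have hj := Finset.mem_univ j
  rw [← this] at hj
  exact (Finset.mem_filter.1 hj).2

theorem existsUnique_mem_openPart (H : Factorization f k α β) (j : Fin (f.natDegree - k)) :
    ∃! B, IsBarK f k B ∧ β j ∈ openPart f k B := by
  obtain ⟨P, hP, hj⟩ := exists_mem_openPart H.isBarK_zer.1 (H.mem_ball_zer j)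
  exact ⟨P, ⟨hP, hj⟩, fun Q hQ => eq_of_mem_openPart H.zer_nonempty hQ.1 hP hQ.2 hj⟩

/-- The roots of the characteristic polynomial of a bar correspond to its postbars. -/
theorem rootMultiplicity_charPoly (H : Factorization f k α β)
    (hB : IsBar f B) (hh : height B = h) (hc : c ∈ ball B)
    {P : Finset (FracSeries K)} (hP : P ∈ postbars B) {a : FracSeries K} (ha : a ∈ P) :
    (charPoly f c h).rootMultiplicity ((a : HahnSeries ℚ K).coeff h) = m f P := by
  classical
  obtain ⟨u, hu, e⟩ := H.exists_charPoly_eq_of_mem_ball hh hc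
  have haB := postbar_subset hP ha
  rw [e, rootMultiplicity_C_mul_prod_X_sub_C hu, (IsBar.post hB hP).m_eq_card, Finset.filter_filter]
  refine H.card_filter_mem P
    (fun b => b ∈ ball B ∧ (b : HahnSeries ℚ K).coeff h = (a : HahnSeries ℚ K).coeff h) fun b => ?_
  rw [mem_postbar_iff hP ha, hh]
  constructor
  · rintro ⟨hb, hab⟩
    exact ⟨hB.subset_zer hb, subset_ball hb, ((lt_contact_iff_coeff_eq hab.le).1 hab).symm⟩
  · rintro ⟨hb, hbB, hab⟩
    have hle := (mem_ball_iff haB).1 hbB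
    exact ⟨hB.mem_of_mem_ball hb hbB, (lt_contact_iff_coeff_eq (hh ▸ hle)).2 hab.symm⟩

theorem contact_eq_height_of_isRegular (H : Factorization f k α β)
    (hB : IsBarK f k B) (hh : height B = h) (hc : c ∈ ball B)
    (hreg : IsRegular k (charPoly f c h)) {i : Fin f.natDegree} {j : Fin (f.natDegree - k)}
    (hi : α i ∈ ball B) (hj : β j ∈ openPart f k B) : contact (α i) (β j) = height B := by
  classical
  rw [mem_openPart] at hj
  have hle := le_contact_of_mem_ball hi hj.1
  refine hle.antisymm' (not_lt.1 fun hlt => ?_)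
  rw [hh] at hlt hle
  have hcoeff := (lt_contact_iff_coeff_eq hle).1 hlt
  have hiB : α i ∈ B := hB.1.mem_of_mem_ball (H.mem_zer.2 ⟨i, rfl⟩) hi
  obtain ⟨P, hP, hiP⟩ := exists_postbar_mem
    (two_le_card_of_height_lt_top (hh ▸ WithTop.coe_lt_top h)) hiB
  have hmult := H.rootMultiplicity_charPoly hB.1 hh hc hP hiP
  obtain ⟨u, hu, eu⟩ := H.exists_charPoly_eq_of_mem_ball hh hc
  obtain ⟨v, hv, ev⟩ := H.exists_iterate_derivative_charPoly_eq_of_mem_ball hB hh hc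
  have hroot : (charPoly f c h).IsRoot ((α i : HahnSeries ℚ K).coeff h) := by
    rw [eu, isRoot_C_mul_prod_X_sub_C hu]
    exact ⟨i, by simpa using hi, rfl⟩
  have hroot' : (derivative^[k] (charPoly f c h)).IsRoot ((α i : HahnSeries ℚ K).coeff h) := by
    rw [ev, isRoot_C_mul_prod_X_sub_C hv]
    exact ⟨j, by simpa using hj.1, hcoeff.symm⟩
  have hk : k < m f P := by
    rw [← hmult]
    by_contra! hk
    exact (hreg.resolve_left (H.iterate_derivative_charPoly_ne_zero hB hh hc)) _ hroot hk hroot'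
  have hPk : IsBarK f k P := ⟨.post hB.1 hP, hk.le⟩
  have hcount := rootMultiplicity_iterate_derivative (charPoly f c h)
    ((α i : HahnSeries ℚ K).coeff h) (k := k) (hmult ▸ hk.le)
  rw [ev, rootMultiplicity_C_mul_prod_X_sub_C hv, hmult, Finset.filter_filter] at hcount
  have hsub : (Finset.univ.filter fun j => β j ∈ ball P) ⊆ Finset.univ.filter fun j =>
      β j ∈ ball B ∧ (β j : HahnSeries ℚ K).coeff h = (α i : HahnSeries ℚ K).coeff h := by
    intro j' hj'
    have hj' := (Finset.mem_filter.1 hj').2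
    have hlt' := height_lt_contact_of_mem_ball_postbar hP hiP hj'
    rw [hh] at hlt'
    exact Finset.mem_filter.2 ⟨Finset.mem_univ _, ball_mono (postbar_subset hP) hj',
      ((lt_contact_iff_coeff_eq hlt'.le).1 hlt').symm⟩
  -- Both sets have `m(P) - k` elements, so every `β` in the ball of `B` with this coefficient
  -- already lies in the ball of `P`.
  have heq := Finset.eq_of_subset_of_card_le hsub (by rw [hcount, H.card_mem_ball hPk, n])
  have hjP : j ∈ Finset.univ.filter fun j => β j ∈ ball P := by
    rw [heq]
    exact Finset.mem_filter.2 ⟨Finset.mem_univ _, hj.1, hcoeff.symm⟩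
  exact hj.2 P hP hPk (Finset.mem_filter.1 hjP).2

theorem exists_height_lt_contact_of_not_isRegular (H : Factorization f k α β)
    (hB : IsBarK f k B) (hh : height B = h)
    (hc : c ∈ ball B) (hreg : ¬ IsRegular k (charPoly f c h)) :
    ∃ i j, α i ∈ ball B ∧ β j ∈ openPart f k B ∧ height B < contact (α i) (β j) := by
  classical
  obtain ⟨u, hu, eu⟩ := H.exists_charPoly_eq_of_mem_ball hh hc
  obtain ⟨v, hv, ev⟩ := H.exists_iterate_derivative_charPoly_eq_of_mem_ball hB hh hc
  rw [IsRegular, not_or] at hreg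
  push Not at hreg
  obtain ⟨-, z, hz, hzk, hz'⟩ := hreg
  rw [eu, isRoot_C_mul_prod_X_sub_C hu] at hz
  obtain ⟨i, hi, rfl⟩ := hz
  have hzj := hz'
  rw [ev, isRoot_C_mul_prod_X_sub_C hv] at hzj
  obtain ⟨j, hj, hij⟩ := hzj
  have hi := (Finset.mem_filter.1 hi).2
  have hj := (Finset.mem_filter.1 hj).2
  have hle := le_contact_of_mem_ball hi hj
  have hlt : height B < contact (α i) (β j) := by
    rw [hh] at hle ⊢
    exact (lt_contact_iff_coeff_eq hle).2 hij.symm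
  refine ⟨i, j, hi, mem_openPart.2 ⟨hj, fun P hP hPk hjP => ?_⟩, hlt⟩
  -- If `β j` lay in the ball of `P`, so would `α i`, and `z` would have multiplicity `m(P) ≥ k` in
  -- `F_B`. With `hzk` it equals `k`, so `z` is not a root of `F_B^(k)`, against `hz'`.
  obtain ⟨a, ha⟩ := postbar_nonempty hP
  have hia : height B < contact a (α i) :=
    lt_contact_trans (height_lt_contact_of_mem_ball_postbar hP ha hjP) (contact_comm (α i) (β j) ▸ hlt)
  have hiP : α i ∈ P := (mem_postbar_iff hP ha).2
    ⟨hB.1.mem_of_mem_ball (H.mem_zer.2 ⟨i, rfl⟩) hi, hia⟩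
  have hmult := H.rootMultiplicity_charPoly hB.1 hh hc hP hiP
  have hcount := rootMultiplicity_iterate_derivative (charPoly f c h)
    ((α i : HahnSeries ℚ K).coeff h) (k := k) (hmult ▸ hPk.2)
  have hpos := (rootMultiplicity_pos (H.iterate_derivative_charPoly_ne_zero hB hh hc)).2 hz'
  omega

end Factorization

end KuoLu

theorem mainTheorem6 {K : Type*} [Field K] [IsAlgClosed K] [CharZero K]
    (f : Polynomial (PowerSeries K)) (hf : KuoLu.IsWeierstrass f) (hsq : Squarefree f)
    (k : ℕ) (hk : 1 ≤ k) (hkn : k ≤ f.natDegree)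
    (α : Fin f.natDegree → KuoLu.FracSeries K)
    (hα : f.map (KuoLu.incl K) = ∏ i, (Polynomial.X - Polynomial.C (α i)))
    (β : Fin (f.natDegree - k) → KuoLu.FracSeries K)
    (hβ : (KuoLu.normDeriv k f).map (KuoLu.incl K) =
      ∏ j, (Polynomial.X - Polynomial.C (β j))) :
    -- (i)
    (∀ B, KuoLu.IsBarK f k B → {j | β j ∈ KuoLu.ball B}.ncard = KuoLu.n f k B) ∧
    -- (ii)
    (∀ B, KuoLu.IsBarK f k B →
      ({j | β j ∈ KuoLu.openPart f k B}.ncard : ℤ) = KuoLu.t f k B) ∧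
    -- (iii)
    (∀ j, ∃! B, KuoLu.IsBarK f k B ∧ β j ∈ KuoLu.openPart f k B) ∧
    -- (iv), for the bars of finite height; `c` is any element of the pseudo-ball
    (∀ B, KuoLu.IsBarK f k B → ∀ h : ℚ, KuoLu.height B = (h : WithTop ℚ) →
      ∀ c ∈ KuoLu.ball B,
        (KuoLu.IsRegular k (KuoLu.charPoly f c h) →
          ∀ i j, α i ∈ KuoLu.ball B → β j ∈ KuoLu.openPart f k B →
            KuoLu.contact (α i) (β j) = KuoLu.height B) ∧
        (¬ KuoLu.IsRegular k (KuoLu.charPoly f c h) →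
          ∃ i j, α i ∈ KuoLu.ball B ∧ β j ∈ KuoLu.openPart f k B ∧
            KuoLu.height B < KuoLu.contact (α i) (β j))) := by
  classical
  have H : KuoLu.Factorization f k α β := ⟨hf.1, hsq, hk, hkn, hα, hβ⟩
  have hncard : ∀ s : Set (KuoLu.FracSeries K),
      {j | β j ∈ s}.ncard = (Finset.univ.filter fun j => β j ∈ s).card := fun s => by
    rw [← Set.ncard_coe_finset]
    simp
  refine ⟨fun B hB => ?_, fun B hB => ?_, H.existsUnique_mem_openPart, fun B hB h hh c hc =>
    ⟨fun hreg i j hi hj => H.contact_eq_height_of_isRegular hB hh hc hreg hi hj,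
      H.exists_height_lt_contact_of_not_isRegular hB hh hc⟩⟩
  · rw [hncard]
    exact H.card_mem_ball hB
  · rw [hncard]
    exact H.card_mem_openPart hB
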